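/- **Setting.** There are $k\ge 1$ actions; an instance is a vector $p=(p_1,\dots,p_k)\in[0,1]^k$, and each sample of action $i$ is an independent Bernoulli variable of mean $p_i$. Let $x\in[0,1]$, $\epsilon\ge 0$, $x_\epsilon=\{y\in\mathbb R:|y-x|<\epsilon\}$ if $\epsilon>0$ and $x_0=\{x\}$. A set $J\subseteq[k]$ of actions is feasible for $p$ if the convex hull of $\{p_i\}_{i\in J}$ meets $x_\epsilon$; the instance $p$ is $(x,\epsilon)$-feasible if $[k]$ is feasible for it, and $(x,\epsilon)$-infeasible otherwise. It is infeasible with a margin if it is $(x,\epsilon')$-infeasible for some $\epsilon'>\epsilon$. Let $D(p|q)\in[0,\infty]$ be the Kullback–Leibler divergence between the Bernoulli laws of means $p$ and $q$, with $D(p|q)=\infty$ if $q\notin[0,1]$, and let $1/0=\infty$, $1/\infty=0$, $\infty\cdot 0=0$. A deterministic policy maps the history of sampled actions and observed outcomes either to the next action to sample or to termination with output *feasible* or *infeasible*; $\tau\in\mathbb N\cup\{\infty\}$ is the number of samples drawn before termination. The policy is $(1-\delta)$-sound on a class $\mathcal M$ of instances if for every $p\in\mathcal M$ we have $E_p[\tau]<\infty$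 and, with $P_p$-probability at least $1-\delta$, the policy terminates with the correct output. For an instance $\nu=(p_1,\dots,p_k)$ let $\Omega$ be the set of its feasible subsets $J\subseteq[k]$, let $\Omega_{\min}\subseteq\Omega$ consist of the inclusion-minimal ones, and put $$d(J)=\inf\Big\{\sum_{i\in J}D(p_i|p'_i)\ :\ p'\in[0,1]^k\ \text{is}\ (x,\epsilon)\text{-infeasible}\Big\}.$$ **Theorem (oracle feasible case).** Let $0<\delta<1/2$, let $\nu=(p_1,\dots,p_k)$ with $p_1\ge\dots\ge p_k$ be $(x,\epsilon)$-feasible, and let $\mathcal M$ be a class of instances that contains $\nu$ and every instance $q_1\ge\dots\ge q_k$ that is infeasible with a margin. Let $\pi$ be a deterministic policy that is $(1-\delta)$-sound on $\mathcal M$, and let $\mathcal J^*$ be an optimal subset in one of the following senses: * (all feasible subsets compete) $\mathcal J^*\in\arg\max_{J\in\Omega}d(J)$; or * (minimal feasible subsets compete, and the learner is told the optimal subset) $\mathcal J^*\in\arg\max_{J\in\Omega_{\min}}d(J)$, and $\pi$ plays only actions in $\mathcal J^*$. Write $L=\max\{0,\tfrac12\log\tfrac1{4\delta}\}$. Then $$E_\nu[\tau]\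 \ge\ \begin{cases}\max\left\{\dfrac1{D(p_{l^*}|x-\epsilon)},\dfrac1{D(p_{l^*}|x+\epsilon)}\right\}L & \text{if }\mathcal J^*=\{l^*\},\\[3mm]\left[\dfrac1{D(p_1|x-\epsilon)}+\dfrac1{D(p_k|x+\epsilon)}\right]L & \text{if }\mathcal J^*=\{1,k\}.\end{cases}$$ -/

import Mathlib

open MeasureTheory ProbabilityTheory unitInterval
open scoped ENNReal

namespace HullFeasibility

noncomputable section

/-! ### Instances and feasibility -/

/-- The target set `x_ε`: the open interval of radius `ε` around `x`, and `{x}` when `ε = 0`. -/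
def target (x ε : ℝ) : Set ℝ :=
  if ε = 0 then {x} else Metric.ball x ε

/-- The means of the actions in `J` are `(x, ε)`-feasible: some point of `x_ε` lies in their
convex hull. An instance is a vector `p` of Bernoulli means, one per action. -/
def SubsetFeasible {k : ℕ} (x ε : ℝ) (p : Fin k → I) (J : Finset (Fin k)) : Prop :=
  ∃ y ∈ target x ε, y ∈ convexHull ℝ ((fun i => (p i : ℝ)) '' (J : Set (Fin k)))

/-- The instance `p` is `(x, ε)`-feasible; otherwise it is `(x, ε)`-infeasible. -/
def Feasible {k : ℕ} (x ε : ℝ) (p : Fin k → I) : Prop :=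
  SubsetFeasible x ε p Finset.univ

/-- The instance is infeasible with some margin: it remains infeasible when `ε` is replaced by
a slightly larger radius. These are the infeasible instances off the boundary with the
feasible ones. -/
def StrictlyInfeasible {k : ℕ} (x ε : ℝ) (p : Fin k → I) : Prop :=
  ∃ ε' > ε, ¬ Feasible x ε' p

/-! ### Divergence and optimal subsets -/

/-- `D(p | q)`, the Kullback-Leibler divergence between the Bernoulli laws with means `p` and `q`.
If `q` is not in `[0, 1]` there is no such law, and the divergence is `∞`. -/
def bernoulliKL (p : I) (q : ℝ) : ℝ≥0∞ :=
  open Classical in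
  if hq : q ∈ I then
    InformationTheory.klDiv (bernoulliMeasure true false p) (bernoulliMeasure true false ⟨q, hq⟩)
  else ⊤

/-- The family `Ω` of all subsets of actions whose means are feasible. -/
def feasibleSubsets {k : ℕ} (x ε : ℝ) (p : Fin k → I) : Set (Finset (Fin k)) :=
  {J | SubsetFeasible x ε p J}

/-- The feasible subsets that contain no smaller feasible subset. -/
def minimalFeasibleSubsets {k : ℕ} (x ε : ℝ) (p : Fin k → I) : Set (Finset (Fin k)) :=
  {J | Minimal (fun J' => J' ∈ feasibleSubsets x ε p) J}

/-- The distance of the actions in `J` from the infeasible instances. -/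
def infeasibilityDist {k : ℕ} (x ε : ℝ) (p : Fin k → I) (J : Finset (Fin k)) : ℝ≥0∞ :=
  ⨅ q ∈ {q : Fin k → I | ¬ Feasible x ε q}, ∑ i ∈ J, bernoulliKL (p i) (q i)

/-- The members of the family `C` that are furthest from the infeasible instances. -/
def optimalIn {k : ℕ} (C : Set (Finset (Fin k))) (x ε : ℝ) (p : Fin k → I) :
    Set (Finset (Fin k)) :=
  {J | J ∈ C ∧ ∀ J' ∈ C, infeasibilityDist x ε p J' ≤ infeasibilityDist x ε p J}

/-! ### Policies and their runs -/

/-- What a policy does next: sample an action, or terminate with an output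
(`true` for feasible, `false` for infeasible). -/
inductive Decision (k : ℕ) : Type
  | sample (i : Fin k) : Decision k
  | terminate (output : Bool) : Decision k

/-- A deterministic policy: a map from the history of (action, observed sample) pairs, most recent
first, to the next decision. -/
abbrev Policy (k : ℕ) : Type := List (Fin k × Bool) → Decision k

/-- The samples: `ω (t, i)` is what action `i` yields if it is sampled in round `t`. -/
abbrev SampleSpace (k : ℕ) : Type := ℕ × Fin k → Bool

/-- Under the instance `p` all samples are independent, those of action `i` Bernoulli of
mean `p i`. -/
def law {k : ℕ} (p : Fin k → I) : Measure (SampleSpace k) :=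
  Measure.infinitePi fun ti : ℕ × Fin k => bernoulliMeasure true false (p ti.2)

namespace Policy

variable {k : ℕ}

/-- The history of the run of `π` on `ω` after `t` rounds; it no longer changes once `π` has
terminated. -/
def history (π : Policy k) (ω : SampleSpace k) : ℕ → List (Fin k × Bool)
  | 0 => []
  | t + 1 =>
    match π (history π ω t) with
    | .sample i => (i, ω (t, i)) :: history π ω t
    | .terminate _ => history π ω t

/-- The run terminates with output `b`. -/
def Outputs (π : Policy k) (ω : SampleSpace k) (b : Bool) : Prop :=
  ∃ t, π (π.history ω t) = .terminate b

/-- The stopping time `τ`: the number of samples drawn before termination, `∞` if the run never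
terminates. -/
def stoppingTime (π : Policy k) (ω : SampleSpace k) : ℝ≥0∞ :=
  ⨅ (t : ℕ) (_ : ∃ b, π (π.history ω t) = .terminate b), (t : ℝ≥0∞)

/-- `E_p[τ]`. -/
def expectedStoppingTime (π : Policy k) (p : Fin k → I) : ℝ≥0∞ :=
  ∫⁻ ω, π.stoppingTime ω ∂(law p)

/-- `π` is `(1 - δ)`-sound on the class `M` of instances: at each of them its expected stopping time
is finite and it outputs the correct case with probability at least `1 - δ`. -/
def SoundOn (π : Policy k) (x ε δ : ℝ) (M : Set (Fin k → I)) : Prop :=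
  ∀ p ∈ M, π.expectedStoppingTime p < ⊤ ∧
    (Feasible x ε p → 1 - δ ≤ (law p).real {ω | π.Outputs ω true}) ∧
    (¬ Feasible x ε p → 1 - δ ≤ (law p).real {ω | π.Outputs ω false})

/-- Only actions in `J` are ever played. -/
def PlaysOnly (π : Policy k) (J : Finset (Fin k)) : Prop :=
  ∀ ω t i, π (π.history ω t) = .sample i → i ∈ J

end Policy

end

end HullFeasibility

open HullFeasibility

/-! A sound policy must answer differently at `p` and at an infeasible alternative `q`, so its run
has to gather enough information to tell them apart. If every action the run can play has divergence
at most `C` from `p` to `q`, each sample contributes at most `C`. A change of measure along the run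
(`integral_comp_history_le`), tested on the output, gives log(1/(4δ)) ≤ C · E[τ]: this is
`log_le_mul_expectedStoppingTime`.

It remains to find cheap alternatives. On the line, an infeasible instance lies wholly on one side
of the target (`feasible_of_lt_of_lt`), so the cheapest ones truncate all means at x - ε from above,
or at x + ε from below. Truncation keeps the order of the means but may only reach the boundary.
Shrinking by a factor s < 1 creates a margin at an extra cost of at most -log s, which tends to 0
(`le_mul_of_lower_pos`, `le_mul_of_upper_lt_one`).

The costs of the lower truncation are dominated by that of the largest mean, those of the upper one
by that of the smallest mean; averaging the two bounds gives the pair case and accounts for the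
factor 1/2. For a singleton {l} optimal among all feasible subsets, C = d([k]) is admissible, and
d([k]) ≤ d({l}) ≤ D(p_l | x ± ε). A learner confined to {l} only pays for the divergence of l.

`BoundedByAlternatives` abstracts the information bound, so that the same limiting arguments bound
both E[τ] and d({l}). -/

namespace HullFeasibility

/-! ### Bernoulli divergence: formula, variational inequality, monotonicity -/

/-- The real-valued formula for the Kullback-Leibler divergence of Bernoulli laws. -/
noncomputable def klReal (p q : ℝ) : ℝ :=
  p * Real.log (p / q) + (1 - p) * Real.log ((1 - p) / (1 - q))

lemma absolutelyContinuous_bernoulliMeasure_iff (p q : I) :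
    bernoulliMeasure true false p ≪ bernoulliMeasure true false q ↔
      ((q : ℝ) = 0 → (p : ℝ) = 0) ∧ ((q : ℝ) = 1 → (p : ℝ) = 1) := by
  constructor
  · intro h
    refine ⟨fun hq => ?_, fun hq => ?_⟩
    · have hq' : q = 0 := Subtype.ext hq
      have := @h {true} (by simp [hq'])
      have := congrArg ENNReal.toReal this
      rw [← measureReal_def, bernoulliMeasure_real_apply _ (by measurability)] at this
      simpa using this
    · have hq' : q = 1 := Subtype.ext hq
      have := @h {false} (by simp [hq'])
      have := congrArg ENNReal.toReal this
      rw [← measureReal_def, bernoulliMeasure_real_apply _ (by measurability)] at this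
      have : 1 - (p : ℝ) = 0 := by simpa using this
      linarith
  · rintro ⟨h0, h1⟩ s hs
    classical
    rw [← measureReal_eq_zero_iff, bernoulliMeasure_real_apply _ (by measurability)] at hs ⊢
    split_ifs at hs ⊢ with ht hf hf
    · exact hs
    · exact h0 hs
    · have hs : 1 - (q : ℝ) = 0 := hs
      simp [h1 (by linarith)]
    · rfl

lemma bernoulliKL_eq_top {p q : I}
    (h : ¬ (((q : ℝ) = 0 → (p : ℝ) = 0) ∧ ((q : ℝ) = 1 → (p : ℝ) = 1))) :
    bernoulliKL p q = ⊤ := by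
  rw [bernoulliKL, dif_pos q.2]
  exact InformationTheory.klDiv_of_not_ac
    (fun h' => h ((absolutelyContinuous_bernoulliMeasure_iff p q).1 h'))

lemma rnDeriv_mul_singleton {α : Type*} [MeasurableSpace α] [MeasurableSingletonClass α]
    (μ ν : Measure α) [IsFiniteMeasure μ] [IsFiniteMeasure ν] (h : μ ≪ ν) (a : α) :
    μ.rnDeriv ν a * ν {a} = μ {a} := by
  conv_rhs => rw [← Measure.withDensity_rnDeriv_eq μ ν h]
  rw [withDensity_apply _ (measurableSet_singleton a), lintegral_singleton]

lemma bernoulliKL_eq_ofReal {p q : I}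
    (h : ((q : ℝ) = 0 → (p : ℝ) = 0) ∧ ((q : ℝ) = 1 → (p : ℝ) = 1)) :
    bernoulliKL p q = ENNReal.ofReal (klReal p q) := by
  have hac := (absolutelyContinuous_bernoulliMeasure_iff p q).2 h
  rw [bernoulliKL, dif_pos q.2]
  set μ := bernoulliMeasure true false p
  set ν := bernoulliMeasure true false q
  have hint : Integrable (llr μ ν) μ := .of_finite
  rw [← ENNReal.ofReal_toReal (InformationTheory.klDiv_ne_top hac hint),
    InformationTheory.toReal_klDiv_of_measure_eq hac (by simp [μ, ν])]
  congr 1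
  have ht := congrArg ENNReal.toReal (rnDeriv_mul_singleton μ ν hac true)
  have hf := congrArg ENNReal.toReal (rnDeriv_mul_singleton μ ν hac false)
  have e1 : ∀ r : I, (bernoulliMeasure true false r {true}).toReal = r := fun r => by
    rw [← measureReal_def, bernoulliMeasure_real_apply _ (by measurability)]; simp
  have e2 : ∀ r : I, (bernoulliMeasure true false r {false}).toReal = 1 - r := fun r => by
    rw [← measureReal_def, bernoulliMeasure_real_apply _ (by measurability)]; simp
  rw [ENNReal.toReal_mul, e1, e1] at ht
  rw [ENNReal.toReal_mul, e2, e2] at hf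
  rw [integral_bernoulliMeasure]
  simp only [llr, klReal, smul_eq_mul]
  congr 1
  · by_cases hq : (q : ℝ) = 0
    · simp [h.1 hq]
    · rw [← ht, mul_div_cancel_right₀ _ hq]
  · by_cases hq : (q : ℝ) = 1
    · simp [h.2 hq]
    · rw [← hf, mul_div_cancel_right₀ _ (sub_ne_zero.2 (Ne.symm hq))]

lemma bernoulliKL_ne_top_iff {p q : I} :
    bernoulliKL p q ≠ ⊤ ↔ ((q : ℝ) = 0 → (p : ℝ) = 0) ∧ ((q : ℝ) = 1 → (p : ℝ) = 1) := by
  refine ⟨fun h => by_contra fun h' => h (bernoulliKL_eq_top h'), fun h => ?_⟩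
  simp [bernoulliKL_eq_ofReal h]

lemma bernoulliKL_self (p : I) : bernoulliKL p p = 0 := by
  rw [bernoulliKL, dif_pos p.2]
  exact InformationTheory.klDiv_self _

lemma mem_unitInterval_of_bernoulliKL_ne_top {p : I} {c : ℝ} (h : bernoulliKL p c ≠ ⊤) :
    c ∈ I := by
  by_contra hc
  exact h (dif_neg hc)

lemma bernoulliKL_symm (p q : I) : bernoulliKL (σ p) (σ q : I) = bernoulliKL p q := by
  by_cases h : ((q : ℝ) = 0 → (p : ℝ) = 0) ∧ ((q : ℝ) = 1 → (p : ℝ) = 1)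
  · rw [bernoulliKL_eq_ofReal h, bernoulliKL_eq_ofReal]
    · simp [klReal]; ring_nf
    · simp only [coe_symm_eq]
      exact ⟨fun hq => by linarith [h.2 (by linarith)], fun hq => by linarith [h.1 (by linarith)]⟩
  · rw [bernoulliKL_eq_top h, bernoulliKL_eq_top]
    intro h'
    simp only [coe_symm_eq] at h'
    exact h ⟨fun hq => by linarith [h'.2 (by linarith)], fun hq => by linarith [h'.1 (by linarith)]⟩

lemma mul_log_le_of_le {w z y : ℝ} (hw : 0 ≤ w) (hy : w ≠ 0 → 0 < z ∧ 0 < y) :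
    w * Real.log z ≤ w * Real.log y + w * (z / y - 1) := by
  rcases eq_or_ne w 0 with rfl | h
  · simp
  obtain ⟨hz, hy⟩ := hy h
  have := Real.log_le_sub_one_of_pos (div_pos hz hy)
  rw [Real.log_div hz.ne' hy.ne'] at this
  nlinarith

/-- The Donsker-Varadhan inequality for Bernoulli laws. -/
lemma klReal_variational {p q : ℝ} (hp : p ∈ I) (hq : q ∈ I)
    (h : (q = 0 → p = 0) ∧ (q = 1 → p = 1)) {a b : ℝ} (ha : 0 < a) (hb : 0 < b) :
    p * Real.log a + (1 - p) * Real.log b ≤ klReal p q + Real.log (q * a + (1 - q) * b) := by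
  obtain ⟨hp0, hp1⟩ := hp
  obtain ⟨hq0, hq1⟩ := hq
  have hm : 0 < q * a + (1 - q) * b := by
    rcases hq0.eq_or_lt with rfl | hq0
    · simpa
    · have : 0 ≤ (1 - q) * b := mul_nonneg (by linarith) hb.le
      positivity
  set m := q * a + (1 - q) * b with hmdef
  -- This is log t ≤ t - 1 at t = c / ((u / v) m). The remainders v c / m - u of the two outcomes
  -- add up to 1 - 1 = 0.
  have key : ∀ u v c : ℝ, 0 ≤ u → 0 ≤ v → 0 < c → (v = 0 → u = 0) →
      u * Real.log c ≤ u * Real.log (u / v) + u * Real.log m + (v * c / m - u) := by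
    intro u v c hu hv hc huv
    rcases hu.eq_or_lt with rfl | hu
    · simp; positivity
    have hv : 0 < v := hv.lt_of_ne' fun h => hu.ne' (huv h)
    have := mul_log_le_of_le (z := c) (y := u / v * m) hu.le (fun _ => ⟨hc, by positivity⟩)
    rw [Real.log_mul (by positivity) hm.ne'] at this
    have e : u * (c / (u / v * m) - 1) = v * c / m - u := by field_simp
    linarith
  have k1 := key p q a hp0 hq0 ha h.1
  have k2 := key (1 - p) (1 - q) b (by linarith) (by linarith) hb
    (fun hq => by linarith [h.2 (by linarith)])
  have e : q * a / m + (1 - q) * b / m = 1 := by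
    rw [← add_div, ← hmdef, div_self hm.ne']
  rw [klReal]
  nlinarith

/-- Away from the endpoints, log t ≤ t - 1 bounds the change by (q' - q) ((1 - p)/(1 - q') - p/q'),
which is nonpositive because q' ≤ p. -/
lemma klReal_le_of_le_of_le {p q q' : ℝ} (hp : p ∈ I) (hq : 0 ≤ q) (hqq : q ≤ q') (hqp : q' ≤ p)
    (h : (q = 0 → p = 0) ∧ (q = 1 → p = 1)) : klReal p q' ≤ klReal p q := by
  obtain ⟨hp0, hp1⟩ := hp
  rcases hp0.eq_or_lt with rfl | hp0
  · rw [show q = q' by linarith]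
  have hq0 : 0 < q := hq.lt_of_ne' fun e => hp0.ne' (h.1 e)
  have hq'0 : 0 < q' := by linarith
  rcases eq_or_ne q' 1 with rfl | hq1
  · have : p = 1 := le_antisymm hp1 hqp
    subst this
    simp only [klReal, sub_self, zero_mul, add_zero, div_one, Real.log_one, mul_zero]
    exact mul_nonneg zero_le_one (Real.log_nonneg (by rw [le_div_iff₀ hq0]; linarith))
  have hq'1 : q' < 1 := lt_of_le_of_ne (by linarith) hq1
  have k1 := mul_log_le_of_le (w := p) (z := p / q') (y := p / q) hp0.le
    (fun _ => ⟨by positivity, by positivity⟩)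
  have k2 := mul_log_le_of_le (w := 1 - p) (z := (1 - p) / (1 - q')) (y := (1 - p) / (1 - q))
    (by linarith) (fun hn => by
      have : 0 < 1 - p := lt_of_le_of_ne (by linarith) (Ne.symm hn)
      exact ⟨div_pos this (by linarith), div_pos this (by linarith)⟩)
  have e1 : p * (p / q' / (p / q) - 1) = p * (q - q') / q' := by field_simp
  have e2 : (1 - p) * ((1 - p) / (1 - q') / ((1 - p) / (1 - q)) - 1)
      = (1 - p) * (q' - q) / (1 - q') := by
    rcases eq_or_ne (1 - p) 0 with e | e
    · simp [e]
    · have : 1 - q' ≠ 0 := by linarith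
      have : 1 - q ≠ 0 := by linarith
      field_simp
      ring
  have e3 : (1 - p) * (q' - q) / (1 - q') ≤ p * (q' - q) / q' := by
    rw [div_le_div_iff₀ (by linarith) hq'0]
    nlinarith [mul_nonneg (sub_nonneg.2 hqq) (sub_nonneg.2 hqp)]
  have e4 : p * (q - q') / q' = - (p * (q' - q) / q') := by ring
  rw [klReal, klReal]
  linarith

lemma klReal_mono_left {c p p' : ℝ} (hc : 0 ≤ c) (hcp : c ≤ p) (hpp : p ≤ p') (hp' : p' ≤ 1)
    (h : (c = 0 → p' = 0)) : klReal p c ≤ klReal p' c := by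
  rcases hc.eq_or_lt with rfl | hc
  · have := h rfl
    rw [show p = p' by linarith]
  rcases eq_or_ne p 1 with rfl | hp1
  · rw [show p' = 1 by linarith]
  have hp1 : p < 1 := lt_of_le_of_ne (by linarith) hp1
  have hc1 : c < 1 := by linarith
  have hp0 : 0 < p := by linarith
  -- The weights are the likelihood ratios of `p` against `c`, so their mean under `c` is 1 and the
  -- logarithm vanishes. What remains on the left is affine in `p'`, has nonnegative slope since c ≤
  -- p, and equals `klReal p c` at p' = p.
  have v := klReal_variational (p := p') (q := c) ⟨by linarith, hp'⟩ ⟨hc.le, hc1.le⟩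
    ⟨fun e => absurd e hc.ne', fun e => absurd e hc1.ne⟩
    (a := p / c) (b := (1 - p) / (1 - c)) (by positivity)
    (div_pos (by linarith) (by linarith))
  rw [mul_div_cancel₀ _ hc.ne', mul_div_cancel₀ _ (by linarith), add_sub_cancel,
    Real.log_one, add_zero] at v
  have l1 : 0 ≤ Real.log (p / c) := Real.log_nonneg (by rw [le_div_iff₀ hc]; linarith)
  have l2 : Real.log ((1 - p) / (1 - c)) ≤ 0 :=
    Real.log_nonpos (div_nonneg (by linarith) (by linarith))
      (by rw [div_le_one (by linarith)]; linarith)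
  rw [klReal]
  nlinarith

/-- Only the success term grows, by -p log s ≤ -log s; the failure term shrinks because 1 - s q ≥ 1
- q. -/
lemma klReal_mul_le {p q s : ℝ} (hp : p ∈ I) (hq : q ∈ I)
    (h : (q = 0 → p = 0) ∧ (q = 1 → p = 1)) (hs0 : 0 < s) (hs1 : s < 1) :
    klReal p (s * q) ≤ klReal p q - Real.log s := by
  obtain ⟨hp0, hp1⟩ := hp
  obtain ⟨hq0, hq1⟩ := hq
  have hls : Real.log s ≤ 0 := Real.log_nonpos hs0.le hs1.le
  have k1 : p * Real.log (p / (s * q)) ≤ p * Real.log (p / q) - Real.log s := by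
    rcases hp0.eq_or_lt with rfl | hp0
    · simpa
    have hq0 : 0 < q := hq0.lt_of_ne' fun e => hp0.ne' (h.1 e)
    rw [show p / (s * q) = p / q / s by field_simp, Real.log_div (by positivity) hs0.ne']
    nlinarith
  have k2 : (1 - p) * Real.log ((1 - p) / (1 - s * q))
      ≤ (1 - p) * Real.log ((1 - p) / (1 - q)) := by
    rcases hp1.eq_or_lt with rfl | hp1
    · simp
    have hq1 : q < 1 := lt_of_le_of_ne hq1 fun e => hp1.ne (h.2 e)
    have : q * s ≤ q := mul_le_of_le_one_right hq0 hs1.le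
    have : 0 < 1 - p := by linarith
    have : 0 < 1 - q := by linarith
    have : 0 < 1 - s * q := by linarith
    gcongr
    linarith
  rw [klReal, klReal]
  linarith

lemma bernoulliKL_le_of_le_of_le {p q q' : I} (hqq : q ≤ q') (hqp : q' ≤ p) :
    bernoulliKL p q' ≤ bernoulliKL p q := by
  by_cases ht : bernoulliKL p q = ⊤
  · simp [ht]
  have h := bernoulliKL_ne_top_iff.1 ht
  have hqq' : (q : ℝ) ≤ q' := hqq
  have hqp' : (q' : ℝ) ≤ p := hqp
  rw [bernoulliKL_eq_ofReal h, bernoulliKL_eq_ofReal]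
  · exact ENNReal.ofReal_le_ofReal (klReal_le_of_le_of_le p.2 q.2.1 hqq hqp h)
  · exact ⟨fun e => h.1 (le_antisymm (e ▸ hqq') q.2.1), fun e => le_antisymm p.2.2 (e ▸ hqp')⟩

lemma bernoulliKL_min_le {p q c : I} (hq : q ≤ c) :
    bernoulliKL p (min p c : I) ≤ bernoulliKL p q := by
  rcases le_total p c with h | h
  · simp [min_eq_left h, bernoulliKL_self]
  · rw [min_eq_right h]
    exact bernoulliKL_le_of_le_of_le hq h

lemma bernoulliKL_min_le_of_le {p p' c : I} (hp : p ≤ p') :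
    bernoulliKL p (min p c : I) ≤ bernoulliKL p' c := by
  rcases le_total p c with h | h
  · simp [min_eq_left h, bernoulliKL_self]
  rw [min_eq_right h]
  by_cases ht : bernoulliKL p' c = ⊤
  · simp [ht]
  have hb := bernoulliKL_ne_top_iff.1 ht
  have hcp : (c : ℝ) ≤ p := h
  have hpp : (p : ℝ) ≤ p' := hp
  rw [bernoulliKL_eq_ofReal hb, bernoulliKL_eq_ofReal]
  · exact ENNReal.ofReal_le_ofReal (klReal_mono_left c.2.1 h hp p'.2.2 hb.1)
  · exact ⟨fun e => le_antisymm (hb.1 e ▸ hpp) p.2.1, fun e => le_antisymm p.2.2 (e ▸ hcp)⟩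

lemma bernoulliKL_mul_le (p q s : I) (hs0 : 0 < s) (hs1 : s < 1) :
    bernoulliKL p (s * q : I) ≤ bernoulliKL p q + ENNReal.ofReal (- Real.log s) := by
  by_cases ht : bernoulliKL p q = ⊤
  · simp [ht]
  have h := bernoulliKL_ne_top_iff.1 ht
  have hs0' : (0 : ℝ) < s := hs0
  have hs1' : (s : ℝ) < 1 := hs1
  rw [bernoulliKL_eq_ofReal h, bernoulliKL_eq_ofReal]
  · have := klReal_mul_le p.2 q.2 h hs0' hs1'
    refine (ENNReal.ofReal_le_ofReal ?_).trans ENNReal.ofReal_add_le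
    rw [Set.Icc.coe_mul]
    linarith
  · rw [Set.Icc.coe_mul]
    refine ⟨fun e => h.1 ((mul_eq_zero.1 e).resolve_left hs0'.ne'), fun e => ?_⟩
    have : (s : ℝ) * q ≤ s := mul_le_of_le_one_right hs0'.le q.2.2
    linarith

/-! ### The law of the history -/

namespace Policy

variable {k : ℕ}

instance (p : Fin k → I) : IsProbabilityMeasure (law p) := by
  unfold law; infer_instance

/-- The coordinates of the sample space revealed before round `t`. -/
def pastCoords (k t : ℕ) : Finset (ℕ × Fin k) := Finset.range t ×ˢ Finset.univ

lemma history_dependsOn (π : Policy k) (t : ℕ) :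
    DependsOn (fun ω => π.history ω t) (pastCoords k t : Set (ℕ × Fin k)) := by
  induction t with
  | zero => intro x y _; rfl
  | succ t ih =>
    intro x y h
    have e : π.history x t = π.history y t := ih fun i hi => h i (by
      simp only [pastCoords, Finset.coe_product, Set.mem_prod, Finset.mem_coe, Finset.mem_range,
        Finset.mem_univ, and_true] at hi ⊢
      omega)
    simp only [history, e]
    cases hd : π (π.history y t) with
    | sample i =>
      dsimp only
      rw [h (t, i) (by simp [pastCoords])]
    | terminate b => rfl

/-- Factoring through finitely many Boolean coordinates makes every function of the history
measurable and integrable, without a σ-algebra on lists. -/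
lemma exists_history_eq_comp (π : Policy k) (t : ℕ) :
    ∃ G : (pastCoords k t → Bool) → List (Fin k × Bool),
      ∀ ω : SampleSpace k, π.history ω t = G (fun i => ω i) := by
  obtain ⟨G, hG⟩ := dependsOn_iff_exists_comp.1 (π.history_dependsOn t)
  exact ⟨G, fun ω => congrFun hG ω⟩

lemma measurable_comp_history {β : Type*} [MeasurableSpace β] (π : Policy k) (t : ℕ)
    (f : List (Fin k × Bool) → β) : Measurable fun ω => f (π.history ω t) := by
  obtain ⟨G, hG⟩ := π.exists_history_eq_comp t
  simp only [hG]
  exact (measurable_of_countable (f ∘ G)).comp (by fun_prop)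

lemma integrable_comp_history (π : Policy k) (p : Fin k → I) (t : ℕ)
    (f : List (Fin k × Bool) → ℝ) : Integrable (fun ω => f (π.history ω t)) (law p) := by
  obtain ⟨G, hG⟩ := π.exists_history_eq_comp t
  simp only [hG]
  have hm : Measurable fun (ω : SampleSpace k) (i : pastCoords k t) => ω i := by fun_prop
  exact (Integrable.of_finite (μ := (law p).map _) (f := f ∘ G)).comp_measurable hm

/-- The samples of round `t` are independent of the earlier coordinates, which determine the
history. -/
lemma integral_comp_history_mul (π : Policy k) (p : Fin k → I) (t : ℕ) (i : Fin k)
    (f : List (Fin k × Bool) → ℝ) (g : Bool → ℝ) :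
    ∫ ω, f (π.history ω t) * g (ω (t, i)) ∂(law p) =
      (∫ ω, f (π.history ω t) ∂(law p)) * (p i * g true + (1 - p i) * g false) := by
  obtain ⟨G, hG⟩ := π.exists_history_eq_comp t
  simp only [hG]
  have hind : iIndepFun (fun (ti : ℕ × Fin k) (ω : SampleSpace k) => ω ti) (law p) :=
    iIndepFun_infinitePi (X := fun _ b => b) (fun _ => measurable_id)
  have h2 := hind.indepFun_finset (pastCoords k t) {(t, i)}
    (by simp [pastCoords]) (fun _ => by fun_prop)
  have h3 := h2.comp (measurable_of_countable (f ∘ G))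
    (measurable_of_countable fun b : ({(t, i)} : Finset (ℕ × Fin k)) → Bool =>
      g (b ⟨(t, i), by simp⟩))
  have h4 := h3.integral_fun_mul_eq_mul_integral
    (((measurable_of_countable (f ∘ G)).comp (by fun_prop)).aestronglyMeasurable)
    (((measurable_of_countable fun b : ({(t, i)} : Finset (ℕ × Fin k)) → Bool =>
      g (b ⟨(t, i), by simp⟩)).comp (by fun_prop)).aestronglyMeasurable)
  refine h4.trans ?_
  congr 1
  have hmap : (law p).map (fun ω : SampleSpace k => ω (t, i)) =
      bernoulliMeasure true false (p i) := Measure.infinitePi_map_eval _ (t, i)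
  have := integral_bernoulliMeasure true false (p i) g
  rw [← hmap, integral_map (measurable_pi_apply (t, i)).aemeasurable
    (measurable_of_countable g).aestronglyMeasurable] at this
  simpa using this

/-- The expectation, under the means `p`, of `g` at the history one round after `h`. -/
noncomputable def stepExp (π : Policy k) (p : Fin k → I) (g : List (Fin k × Bool) → ℝ)
    (h : List (Fin k × Bool)) : ℝ :=
  match π h with
  | .sample i => p i * g ((i, true) :: h) + (1 - p i) * g ((i, false) :: h)
  | .terminate _ => g h

lemma integral_comp_history_succ (π : Policy k) (p : Fin k → I) (t : ℕ)
    (g : List (Fin k × Bool) → ℝ) :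
    ∫ ω, g (π.history ω (t + 1)) ∂(law p) = ∫ ω, π.stepExp p g (π.history ω t) ∂(law p) := by
  classical
  -- Splitting by the action played and the outcome seen makes each term a function of the past
  -- times a function of one fresh sample.
  let φ : Fin k → Bool → List (Fin k × Bool) → ℝ := fun i b h =>
    if π h = .sample i then g ((i, b) :: h) else 0
  let φ₀ : List (Fin k × Bool) → ℝ := fun h => if ∃ b, π h = .terminate b then g h else 0
  let χ : Bool → Bool → ℝ := fun b c => if c = b then 1 else 0
  have e1 : ∀ ω, g (π.history ω (t + 1)) =
      (∑ i, ∑ b, φ i b (π.history ω t) * χ b (ω (t, i))) + φ₀ (π.history ω t) := fun ω => by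
    simp only [history, φ, φ₀, χ]
    cases hd : π (π.history ω t) with
    | sample i =>
      simp only [Decision.sample.injEq, Fintype.sum_bool]
      rw [Finset.sum_eq_single i (fun j _ hj => by simp [hj.symm]) (by simp)]
      cases ω (t, i) <;> simp
    | terminate b => simp
  have e2 : ∀ h, π.stepExp p g h =
      (∑ i, ∑ b, φ i b h * (p i * χ b true + (1 - p i) * χ b false)) + φ₀ h := fun h => by
    simp only [stepExp, φ, φ₀, χ]
    cases hd : π h with
    | sample i =>
      simp only [Decision.sample.injEq, Fintype.sum_bool]
      rw [Finset.sum_eq_single i (fun j _ hj => by simp [hj.symm]) (by simp)]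
      simp
      ring
    | terminate b => simp
  have hi : ∀ i b, Integrable (fun ω => φ i b (π.history ω t) * χ b (ω (t, i))) (law p) :=
    fun i b => by
      refine (π.integrable_comp_history p t (φ i b)).mul_bdd (c := 1)
        ((measurable_of_countable (χ b)).comp (by fun_prop)).aestronglyMeasurable ?_
      refine Filter.Eventually.of_forall fun ω => ?_
      simp only [χ]
      split_ifs <;> simp
  simp only [e1, e2]
  rw [integral_add (integrable_finsetSum _ fun i _ => integrable_finsetSum _ fun b _ => hi i b)
      (π.integrable_comp_history p t φ₀),
    integral_add (integrable_finsetSum _ fun i _ => integrable_finsetSum _ fun b _ =>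
      (π.integrable_comp_history p t (φ i b)).mul_const _) (π.integrable_comp_history p t φ₀),
    integral_finsetSum _ (fun i _ => integrable_finsetSum _ fun b _ => hi i b),
    integral_finsetSum _ (fun i _ => integrable_finsetSum _ fun b _ =>
      (π.integrable_comp_history p t (φ i b)).mul_const _)]
  congr 1
  refine Finset.sum_congr rfl fun i _ => ?_
  rw [integral_finsetSum _ (fun b _ => hi i b), integral_finsetSum _ (fun b _ =>
      (π.integrable_comp_history p t (φ i b)).mul_const _)]
  refine Finset.sum_congr rfl fun b _ => ?_
  rw [integral_comp_history_mul, integral_mul_const]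

/-! ### Change of measure along a run -/

open Classical in
/-- `1` if the policy samples after the history `h`, and `0` if it has terminated. -/
noncomputable def sampling (π : Policy k) (h : List (Fin k × Bool)) : ℝ :=
  if ∃ b, π h = .terminate b then 0 else 1

/-- The Donsker-Varadhan inequality for the laws of the history after `t` rounds. -/
lemma integral_comp_history_le (π : Policy k) (p q : Fin k → I) {C : ℝ} (hC : 0 ≤ C)
    (hpq : ∀ ω t i, π (π.history ω t) = .sample i → bernoulliKL (p i) (q i) ≤ ENNReal.ofReal C)
    (t : ℕ) (g : List (Fin k × Bool) → ℝ) :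
    ∫ ω, g (π.history ω t) ∂(law p) ≤
      C * ∑ s ∈ Finset.range t, ∫ ω, π.sampling (π.history ω s) ∂(law p) +
        Real.log (∫ ω, Real.exp (g (π.history ω t)) ∂(law q)) := by
  induction t generalizing g with
  | zero => simp [history]
  | succ t ih =>
    let E := fun h => Real.exp (g h)
    have hpos : ∀ h, 0 < π.stepExp q E h := fun h => by
      unfold stepExp
      cases π h with
      | sample i =>
        have h1 := (q i).2.1
        have h2 := (q i).2.2
        simp only [E]
        rcases h1.eq_or_lt with h0 | h0
        · rw [← h0]; simp; positivity
        · have : 0 ≤ (1 - (q i : ℝ)) * Real.exp (g ((i, false) :: h)) :=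
            mul_nonneg (by linarith) (Real.exp_pos _).le
          positivity
      | terminate b => exact Real.exp_pos _
    -- A round that samples costs at most `C` by the two-point inequality; after termination both
    -- sides agree at no cost.
    have hstep : ∀ ω, π.stepExp p g (π.history ω t) ≤
        C * π.sampling (π.history ω t) + Real.log (π.stepExp q E (π.history ω t)) := fun ω => by
      unfold stepExp sampling
      cases hd : π (π.history ω t) with
      | sample i =>
        have hb := hpq ω t i hd
        have hb' := bernoulliKL_ne_top_iff.1 (ne_top_of_le_ne_top ENNReal.ofReal_ne_top hb)
        rw [bernoulliKL_eq_ofReal hb', ENNReal.ofReal_le_ofReal_iff hC] at hb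
        have := klReal_variational (p i).2 (q i).2 hb'
          (Real.exp_pos (g ((i, true) :: π.history ω t)))
          (Real.exp_pos (g ((i, false) :: π.history ω t)))
        simp only [Real.log_exp] at this
        simp only [reduceCtorEq, exists_const, ↓reduceIte, E]
        linarith
      | terminate b => simp [E]
    -- The test function for the shorter horizon is the logarithm of the one-step exponential moment
    -- under `q`. Exponentiating it returns that moment, so the logarithms telescope.
    have hih := ih fun h => Real.log (π.stepExp q E h)
    simp only [Real.exp_log (hpos _)] at hih
    rw [integral_comp_history_succ, integral_comp_history_succ π q t E]
    calc _ ≤ ∫ ω, (C * π.sampling (π.history ω t) +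
          Real.log (π.stepExp q E (π.history ω t))) ∂(law p) :=
          integral_mono (π.integrable_comp_history p t _)
            (((π.integrable_comp_history p t _).const_mul C).add
              (π.integrable_comp_history p t fun h => Real.log (π.stepExp q E h))) hstep
      _ = C * ∫ ω, π.sampling (π.history ω t) ∂(law p) +
          ∫ ω, Real.log (π.stepExp q E (π.history ω t)) ∂(law p) := by
          rw [integral_add ((π.integrable_comp_history p t _).const_mul C)
            (π.integrable_comp_history p t fun h => Real.log (π.stepExp q E h)),
            integral_const_mul]
      _ ≤ _ := by
          rw [Finset.sum_range_succ, mul_add]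
          linarith

lemma history_eq_of_terminate (π : Policy k) (ω : SampleSpace k) {s t : ℕ} (hst : s ≤ t) {b : Bool}
    (h : π (π.history ω s) = .terminate b) : π.history ω t = π.history ω s := by
  induction t, hst using Nat.le_induction with
  | base => rfl
  | succ t _ ih => rw [history, ih, h]

lemma sum_sampling_le_stoppingTime (π : Policy k) (ω : SampleSpace k) (t : ℕ) :
    ∑ s ∈ Finset.range t, ENNReal.ofReal (π.sampling (π.history ω s)) ≤ π.stoppingTime ω := by
  refine le_iInf₂ fun t' ⟨b, hb⟩ => ?_
  have hz : ∀ s, t' ≤ s → π.sampling (π.history ω s) = 0 := fun s hs => by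
    rw [π.history_eq_of_terminate ω hs hb, sampling, if_pos ⟨b, hb⟩]
  have h1 : ∀ s, ENNReal.ofReal (π.sampling (π.history ω s)) ≤ if s < t' then 1 else 0 :=
    fun s => by
      split_ifs with hs
      · unfold sampling; split_ifs <;> simp
      · rw [hz s (by omega)]; simp
  calc _ ≤ ∑ s ∈ Finset.range t, if s < t' then (1 : ℝ≥0∞) else 0 :=
        Finset.sum_le_sum fun s _ => h1 s
    _ = (((Finset.range t).filter (· < t')).card : ℝ≥0∞) := by simp
    _ ≤ t' := by
        have : ((Finset.range t).filter (· < t')).card ≤ (Finset.range t').card :=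
          Finset.card_le_card fun s => by simp
        rw [Finset.card_range] at this
        exact_mod_cast this

lemma sum_integral_sampling_le (π : Policy k) (p : Fin k → I)
    (hfin : π.expectedStoppingTime p < ⊤) (t : ℕ) :
    ∑ s ∈ Finset.range t, ∫ ω, π.sampling (π.history ω s) ∂(law p) ≤
      (π.expectedStoppingTime p).toReal := by
  have hnn : ∀ h, 0 ≤ π.sampling h := fun h => by unfold sampling; split_ifs <;> simp
  rw [← ENNReal.ofReal_le_iff_le_toReal hfin.ne,
    ENNReal.ofReal_sum_of_nonneg fun s _ => integral_nonneg fun ω => hnn _]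
  calc _ = ∑ s ∈ Finset.range t, ∫⁻ ω, ENNReal.ofReal (π.sampling (π.history ω s)) ∂(law p) :=
        Finset.sum_congr rfl fun s _ => ofReal_integral_eq_lintegral_ofReal
          (π.integrable_comp_history p s _) (Filter.Eventually.of_forall fun ω => hnn _)
    _ = ∫⁻ ω, ∑ s ∈ Finset.range t, ENNReal.ofReal (π.sampling (π.history ω s)) ∂(law p) :=
        (lintegral_finsetSum _ fun s _ =>
          π.measurable_comp_history s fun h => ENNReal.ofReal (π.sampling h)).symm
    _ ≤ _ := lintegral_mono fun ω => π.sum_sampling_le_stoppingTime ω t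

lemma tendsto_prob_terminate (π : Policy k) (p : Fin k → I) (b : Bool) :
    Filter.Tendsto (fun t => (law p).real {ω | π (π.history ω t) = .terminate b}) Filter.atTop
      (nhds ((law p).real {ω | π.Outputs ω b})) := by
  have hmono : Monotone fun t => {ω | π (π.history ω t) = .terminate b} := fun s t hst ω hω => by
    have hω : π (π.history ω s) = .terminate b := hω
    simp only [Set.mem_ofPred_eq, π.history_eq_of_terminate ω hst hω, hω]
  have := tendsto_measure_iUnion_atTop (μ := law p) hmono
  have e : {ω | π.Outputs ω b} = ⋃ t, {ω | π (π.history ω t) = .terminate b} := by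
    ext ω; simp [Outputs]
  rw [e]
  exact (ENNReal.tendsto_toReal (measure_ne_top _ _)).comp this

lemma measurableSet_terminate (π : Policy k) (t : ℕ) (b : Bool) :
    MeasurableSet {ω | π (π.history ω t) = .terminate b} := by
  classical
  have := π.measurable_comp_history t fun h => decide (π h = .terminate b)
  simpa [Set.preimage] using this (measurableSet_singleton true)

/-- The change-of-measure inequality at a finite horizon, tested against termination
with output `true`. -/
lemma mul_prob_terminate_le (π : Policy k) (p q : Fin k → I) {C : ℝ} (hC : 0 ≤ C)
    (hpq : ∀ ω t i, π (π.history ω t) = .sample i → bernoulliKL (p i) (q i) ≤ ENNReal.ofReal C)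
    (hfin : π.expectedStoppingTime p < ⊤) {a : ℝ} (ha : 1 ≤ a) (t : ℕ) :
    Real.log a * (law p).real {ω | π (π.history ω t) = .terminate true} ≤
      C * (π.expectedStoppingTime p).toReal + Real.log
        (1 + (a - 1) * (1 - (law q).real {ω | π (π.history ω t) = .terminate false})) := by
  classical
  have ha0 : 0 < a := by linarith
  set A := {ω | π (π.history ω t) = .terminate true} with hA
  set B := {ω | π (π.history ω t) = .terminate false} with hB
  have hAm : MeasurableSet A := π.measurableSet_terminate t true
  have hBm : MeasurableSet B := π.measurableSet_terminate t false
  -- The exponential moment of this test function under `q` is 1 + (a - 1) q(A), and `A` is disjoint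
  -- from termination with output `false`.
  let g : List (Fin k × Bool) → ℝ := fun h => if π h = .terminate true then Real.log a else 0
  have key := π.integral_comp_history_le p q hC hpq t g
  have e1 : (fun ω => g (π.history ω t)) = A.indicator fun _ => Real.log a := by
    ext ω; simp [g, A, Set.indicator_apply]
  have e2 : (fun ω => Real.exp (g (π.history ω t))) =
      fun ω => 1 + A.indicator (fun _ => a - 1) ω := by
    ext ω
    by_cases h : π (π.history ω t) = .terminate true <;>
      simp [g, A, h, Real.exp_log ha0]
  rw [e1, e2, integral_indicator_const _ hAm,
    integral_add (integrable_const _) ((integrable_const _).indicator hAm),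
    integral_indicator_const _ hAm] at key
  simp only [smul_eq_mul, integral_const, probReal_univ, one_mul] at key
  have hdisj : (law q).real A + (law q).real B ≤ 1 := by
    rw [← measureReal_union (Set.disjoint_left.2 fun ω h1 h2 => by
      simp only [A, B, Set.mem_ofPred_eq] at h1 h2; simp [h1] at h2) hBm]
    exact measureReal_le_one
  have hs := mul_le_mul_of_nonneg_left (π.sum_integral_sampling_le p hfin t) hC
  have hl : Real.log (1 + (law q).real A * (a - 1)) ≤
      Real.log (1 + (a - 1) * (1 - (law q).real B)) := by
    have : 0 ≤ (law q).real A * (a - 1) := mul_nonneg measureReal_nonneg (by linarith)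
    refine Real.log_le_log (by linarith) ?_
    nlinarith
  linarith

/-- The difference of the two sides is (1 - 2δ) log(4(1 - δ)) + 2δ log(4δ); bounding each logarithm
below by log y ≥ 1 - 1/y shows that it is nonnegative. -/
lemma log_le_of_errors {δ : ℝ} (hδ : 0 < δ) (hδ' : δ < 1 / 2) :
    Real.log (1 / (4 * δ)) ≤ (1 - 2 * δ) * Real.log ((1 - δ) / δ) := by
  have h1 : 0 < 1 - δ := by linarith
  have e : (0 : ℝ) < 1 - 2 * δ := by linarith
  rw [one_div, Real.log_inv, Real.log_mul (by norm_num) hδ.ne', Real.log_div h1.ne' hδ.ne']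
  have k1 := Real.log_le_sub_one_of_pos (x := 1 / (4 * (1 - δ))) (by positivity)
  have k2 := Real.log_le_sub_one_of_pos (x := 1 / (4 * δ)) (by positivity)
  rw [one_div, Real.log_inv, Real.log_mul (by norm_num) h1.ne'] at k1
  rw [one_div, Real.log_inv, Real.log_mul (by norm_num) hδ.ne'] at k2
  have m1 := mul_le_mul_of_nonneg_left k1 e.le
  have m2 := mul_le_mul_of_nonneg_left k2 (show 0 ≤ 2 * δ by linarith)
  have e2 : 2 * δ * ((4 * δ)⁻¹ - 1) = 1 / 2 - 2 * δ := by field_simp; ring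
  have e1 : (1 - 2 * δ) * ((4 * (1 - δ))⁻¹ - 1) ≤ - (1 / 2) + 2 * δ := by
    have : (1 - 2 * δ) * (4 * (1 - δ))⁻¹ ≤ 1 / 2 := by
      rw [← div_eq_mul_inv, div_le_div_iff₀ (by linarith) (by norm_num)]
      linarith
    linarith
  linarith

/-- The transportation inequality: a sound policy cannot separate `p` from `q` without collecting
`log (1 / (4 δ))` of information. -/
theorem log_le_mul_expectedStoppingTime (π : Policy k) (p q : Fin k → I) {δ : ℝ} (hδ : 0 < δ)
    (hδ' : δ < 1 / 2) (hfin : π.expectedStoppingTime p < ⊤)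
    (hp : 1 - δ ≤ (law p).real {ω | π.Outputs ω true})
    (hq : 1 - δ ≤ (law q).real {ω | π.Outputs ω false}) {C : ℝ≥0∞} (hC : C ≠ ⊤)
    (hpq : ∀ ω t i, π (π.history ω t) = .sample i → bernoulliKL (p i) (q i) ≤ C) :
    ENNReal.ofReal (Real.log (1 / (4 * δ))) ≤ C * π.expectedStoppingTime p := by
  -- The weight a = r² is chosen because r + 1 = 1/δ, hence 1 + (r² - 1) δ = r. The error term is
  -- then at most log r, leaving (2(1 - δ) - 1) log r on the left.
  set r := (1 - δ) / δ with hr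
  have hr1 : 1 < r := by rw [hr, lt_div_iff₀ hδ]; linarith
  have ha : 1 ≤ r ^ 2 := one_le_pow₀ hr1.le
  have hlog : 0 ≤ Real.log (r ^ 2) := Real.log_nonneg ha
  have hq1 : (law q).real {ω | π.Outputs ω false} ≤ 1 := measureReal_le_one
  have hβ : 0 < 1 + (r ^ 2 - 1) * (1 - (law q).real {ω | π.Outputs ω false}) := by
    have := mul_nonneg (sub_nonneg.2 ha) (sub_nonneg.2 hq1)
    linarith
  have hlim := le_of_tendsto_of_tendsto'
    ((π.tendsto_prob_terminate p true).const_mul (Real.log (r ^ 2)))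
    ((((((π.tendsto_prob_terminate q false).const_sub 1).const_mul (r ^ 2 - 1)).const_add 1).log
      hβ.ne').const_add (C.toReal * (π.expectedStoppingTime p).toReal))
    (fun t => π.mul_prob_terminate_le p q ENNReal.toReal_nonneg
      (by rwa [ENNReal.ofReal_toReal hC]) hfin ha t)
  have e : 1 + (r ^ 2 - 1) * δ = r := by rw [hr]; field_simp; ring
  have hlr : Real.log (1 + (r ^ 2 - 1) * (1 - (law q).real {ω | π.Outputs ω false})) ≤
      Real.log r := by
    refine Real.log_le_log hβ ?_
    nlinarith
  have h2 := mul_le_mul_of_nonneg_left hp hlog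
  have h3 := log_le_of_errors hδ hδ'
  rw [Real.log_pow] at hlim h2
  push_cast at hlim h2
  rw [← hr] at h3
  rw [ENNReal.ofReal_le_iff_le_toReal (ENNReal.mul_ne_top hC hfin.ne), ENNReal.toReal_mul]
  linarith

end Policy

/-! ### Infeasible instances on the line -/

variable {k : ℕ} {x ε : ℝ}

lemma target_subset_target {ε' : ℝ} (hε : 0 ≤ ε) (h : ε < ε') : target x ε ⊆ target x ε' := by
  intro y hy
  rw [target, if_neg (by linarith : ε' ≠ 0)]
  unfold target at hy
  split_ifs at hy with h0
  · rw [Set.mem_singleton_iff.1 hy]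
    exact Metric.mem_ball_self (by linarith)
  · exact Metric.ball_subset_ball h.le hy

lemma StrictlyInfeasible.not_feasible {q : Fin k → I} (hε : 0 ≤ ε)
    (h : StrictlyInfeasible x ε q) : ¬ Feasible x ε q := by
  obtain ⟨ε', hε', h⟩ := h
  rintro ⟨y, hy, hy'⟩
  exact h ⟨y, target_subset_target hε hε' hy, hy'⟩

lemma SubsetFeasible.exists_le {p : Fin k → I} {J : Finset (Fin k)}
    (h : SubsetFeasible x ε p J) :
    ∃ y ∈ target x ε, (∃ i ∈ J, y ≤ p i) ∧ ∃ i ∈ J, (p i : ℝ) ≤ y := by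
  obtain ⟨y, hy, hull⟩ := h
  refine ⟨y, hy, ?_, ?_⟩ <;> by_contra! hc
  · have : convexHull ℝ ((fun i => (p i : ℝ)) '' (J : Set (Fin k))) ⊆ Set.Iio y :=
      convexHull_min (by rintro _ ⟨i, hi, rfl⟩; exact hc i hi) (convex_Iio y)
    exact lt_irrefl y (this hull)
  · have : convexHull ℝ ((fun i => (p i : ℝ)) '' (J : Set (Fin k))) ⊆ Set.Ioi y :=
      convexHull_min (by rintro _ ⟨i, hi, rfl⟩; exact hc i hi) (convex_Ioi y)
    exact lt_irrefl y (this hull)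

lemma strictlyInfeasible_of_le {q : Fin k → I} (hε : 0 ≤ ε) {b : ℝ} (hb : b < x - ε)
    (h : ∀ i, (q i : ℝ) ≤ b) : StrictlyInfeasible x ε q := by
  refine ⟨x - b, by linarith, fun hf => ?_⟩
  obtain ⟨y, hy, ⟨i, -, hi⟩, -⟩ := hf.exists_le
  rw [target, if_neg (by linarith), Real.ball_eq_Ioo] at hy
  linarith [hy.1, h i]

lemma strictlyInfeasible_of_ge {q : Fin k → I} (hε : 0 ≤ ε) {b : ℝ} (hb : x + ε < b)
    (h : ∀ i, b ≤ (q i : ℝ)) : StrictlyInfeasible x ε q := by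
  refine ⟨b - x, by linarith, fun hf => ?_⟩
  obtain ⟨y, hy, -, ⟨i, -, hi⟩⟩ := hf.exists_le
  rw [target, if_neg (by linarith), Real.ball_eq_Ioo] at hy
  linarith [hy.2, h i]

/-- Either one of the two means falls in the target, or they enclose x. Conversely, an infeasible
instance must lie entirely on one side. -/
lemma feasible_of_lt_of_lt {q : Fin k → I} (hε : 0 ≤ ε) {i j : Fin k}
    (hi : x - ε < q i) (hj : (q j : ℝ) < x + ε) : Feasible x ε q := by
  have hmem : ∀ i, (q i : ℝ) ∈ convexHull ℝ ((fun i => (q i : ℝ)) ''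
      ((Finset.univ : Finset (Fin k)) : Set (Fin k))) :=
    fun i => subset_convexHull _ _ ⟨i, by simp, rfl⟩
  have hball : ∀ y, x - ε < y → y < x + ε → y ∈ target x ε := fun y h1 h2 => by
    rw [target, if_neg (by linarith), Real.ball_eq_Ioo]
    exact ⟨h1, h2⟩
  rcases lt_or_ge (q i : ℝ) x with h1 | h1
  · exact ⟨q i, hball _ hi (by linarith), hmem i⟩
  rcases lt_or_ge x (q j : ℝ) with h2 | h2
  · exact ⟨q j, hball _ (by linarith) hj, hmem j⟩
  refine ⟨x, ?_, (convex_convexHull ℝ _).segment_subset (hmem j) (hmem i) ?_⟩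
  · unfold target
    split_ifs with h0
    · rfl
    · exact Metric.mem_ball_self (hε.lt_of_ne' h0)
  · rw [segment_eq_Icc (h2.trans h1)]
    exact ⟨h2, h1⟩

/-! ### Truncated alternatives and their cost -/

/-- `a` is at most `C * E` whenever every action in `J` has divergence at most `C` between `p`
and some ordered instance that is infeasible with a margin. -/
def BoundedByAlternatives (x ε : ℝ) (p : Fin k → I) (J : Finset (Fin k)) (a E : ℝ≥0∞) : Prop :=
  ∀ q : Fin k → I, Antitone q → StrictlyInfeasible x ε q → ∀ C : ℝ≥0∞, C ≠ ⊤ →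
    (∀ i ∈ J, bernoulliKL (p i) (q i) ≤ C) → a ≤ C * E

lemma le_mul_of_forall_pos {a C E : ℝ≥0∞} (hE : E ≠ ⊤)
    (h : ∀ r : ℝ, 0 < r → a ≤ (C + ENNReal.ofReal r) * E) : a ≤ C * E := by
  have h0 : Filter.Tendsto (fun r : ℝ => (C + ENNReal.ofReal r) * E)
      (nhdsWithin 0 (Set.Ioi 0)) (nhds ((C + ENNReal.ofReal 0) * E)) := by
    refine ENNReal.Tendsto.mul_const (Filter.Tendsto.const_add C ?_) (Or.inr hE)
    exact (ENNReal.continuous_ofReal.tendsto 0).mono_left nhdsWithin_le_nhds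
  rw [ENNReal.ofReal_zero, add_zero] at h0
  exact ge_of_tendsto h0 (Filter.eventually_of_mem self_mem_nhdsWithin fun r hr => h r hr)

lemma exists_neg_log_eq {r : ℝ} (hr : 0 < r) : ∃ s : I, 0 < s ∧ s < 1 ∧ - Real.log s = r :=
  ⟨⟨Real.exp (-r), (Real.exp_pos _).le, Real.exp_le_one_iff.2 (by linarith)⟩,
    Subtype.mk_lt_mk.2 (Real.exp_pos _), Subtype.mk_lt_mk.2 (Real.exp_lt_one_iff.2 (by linarith)),
    by simp⟩

variable {p : Fin k → I} {J : Finset (Fin k)} {a E C : ℝ≥0∞}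

namespace BoundedByAlternatives

lemma le_mul_of_lower_pos (h : BoundedByAlternatives x ε p J a E) (hε : 0 ≤ ε) (hp : Antitone p)
    (hE : E ≠ ⊤) (hC : C ≠ ⊤) {c : I} (hc : (c : ℝ) = x - ε) (hc0 : 0 < c)
    (hJ : ∀ i ∈ J, bernoulliKL (p i) (min (p i) c : I) ≤ C) : a ≤ C * E := by
  refine le_mul_of_forall_pos hE fun r hr => ?_
  obtain ⟨s, hs0, hs1, rfl⟩ := exists_neg_log_eq hr
  have hs0' : (0 : ℝ) < s := hs0
  have hs1' : (s : ℝ) < 1 := hs1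
  have hc0' : (0 : ℝ) < c := hc0
  -- Since c > 0, the bound s c lies strictly below x - ε, which supplies the margin.
  refine h (fun i => s * min (p i) c) (fun i j hij => ?_)
    (strictlyInfeasible_of_le hε (b := s * c) (by rw [← hc]; nlinarith) fun i => ?_) _
    (by simp [hC]) fun i hi => ?_
  · exact mul_le_mul_right (min_le_min_right c (hp hij)) s
  · have : ((min (p i) c : I) : ℝ) ≤ c := min_le_right (p i) c
    rw [Set.Icc.coe_mul]
    gcongr
  · exact (bernoulliKL_mul_le _ _ s hs0 hs1).trans (add_le_add_left (hJ i hi) _)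

lemma le_mul_of_upper_lt_one (h : BoundedByAlternatives x ε p J a E) (hε : 0 ≤ ε)
    (hp : Antitone p) (hE : E ≠ ⊤) (hC : C ≠ ⊤) {c : I} (hc : (c : ℝ) = x + ε) (hc1 : c < 1)
    (hJ : ∀ i ∈ J, bernoulliKL (p i) (max (p i) c : I) ≤ C) : a ≤ C * E := by
  refine le_mul_of_forall_pos hE fun r hr => ?_
  obtain ⟨s, hs0, hs1, rfl⟩ := exists_neg_log_eq hr
  have hs0' : (0 : ℝ) < s := hs0
  have hs1' : (s : ℝ) < 1 := hs1
  have hc1' : (c : ℝ) < 1 := hc1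
  refine h (fun i => σ (s * σ (max (p i) c))) (fun i j hij => ?_)
    (strictlyInfeasible_of_ge hε (b := 1 - s * (1 - c)) (by rw [← hc]; nlinarith) fun i => ?_) _
    (by simp [hC]) fun i hi => ?_
  · exact symm_le_symm.2 (mul_le_mul_right (symm_le_symm.2 (max_le_max_right c (hp hij))) s)
  · have : (c : ℝ) ≤ (max (p i) c : I) := le_max_right (p i) c
    rw [coe_symm_eq, Set.Icc.coe_mul, coe_symm_eq]
    gcongr
  · rw [← bernoulliKL_symm, symm_symm]
    refine (bernoulliKL_mul_le _ _ s hs0 hs1).trans (add_le_add_left ?_ _)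
    rw [bernoulliKL_symm]
    exact hJ i hi

/-- The new case is c = 0, where no mean can be pushed lower. Finite divergence then forces p i = 0
on `J`, which contradicts feasibility if ε > 0. So x = ε = 0, and `p` is already its own upper
truncation, at zero cost. -/
lemma le_mul_of_lower (h : BoundedByAlternatives x ε p J a E) (hε : 0 ≤ ε) (hp : Antitone p)
    (hfeas : SubsetFeasible x ε p J) (hE : E ≠ ⊤) (hC : C ≠ ⊤) {c : I} (hc : (c : ℝ) = x - ε)
    (hJ : ∀ i ∈ J, bernoulliKL (p i) (min (p i) c : I) ≤ C) : a ≤ C * E := by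
  rcases eq_or_ne c 0 with rfl | hc0
  swap
  · exact h.le_mul_of_lower_pos hε hp hE hC hc (unitInterval.pos_iff_ne_zero.2 hc0) hJ
  rw [Set.Icc.coe_zero] at hc
  obtain ⟨y, hy, ⟨i, hi, hyi⟩, -⟩ := hfeas.exists_le
  have h0 : ε = 0 := by
    by_contra h0
    have hi0 := (bernoulliKL_ne_top_iff.1 (ne_top_of_le_ne_top hC (hJ i hi))).1
      (by rw [min_eq_right (nonneg' : 0 ≤ p i)]; rfl)
    rw [target, if_neg h0, Real.ball_eq_Ioo] at hy
    linarith [hy.1]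
  refine h.le_mul_of_upper_lt_one hε hp hE hC (c := 0) ?_ zero_lt_one fun i _ => ?_
  · rw [Set.Icc.coe_zero]; linarith
  · rw [max_eq_left (nonneg' : 0 ≤ p i), bernoulliKL_self]
    exact zero_le

lemma le_mul_of_upper (h : BoundedByAlternatives x ε p J a E) (hε : 0 ≤ ε) (hp : Antitone p)
    (hfeas : SubsetFeasible x ε p J) (hE : E ≠ ⊤) (hC : C ≠ ⊤) {c : I} (hc : (c : ℝ) = x + ε)
    (hJ : ∀ i ∈ J, bernoulliKL (p i) (max (p i) c : I) ≤ C) : a ≤ C * E := by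
  rcases eq_or_ne c 1 with rfl | hc1
  swap
  · exact h.le_mul_of_upper_lt_one hε hp hE hC hc (unitInterval.lt_one_iff_ne_one.2 hc1) hJ
  rw [Set.Icc.coe_one] at hc
  obtain ⟨y, hy, -, ⟨i, hi, hyi⟩⟩ := hfeas.exists_le
  have h0 : ε = 0 := by
    by_contra h0
    have hi0 := (bernoulliKL_ne_top_iff.1 (ne_top_of_le_ne_top hC (hJ i hi))).2
      (by rw [max_eq_right (le_one' : p i ≤ 1)]; rfl)
    rw [target, if_neg h0, Real.ball_eq_Ioo] at hy
    linarith [hy.2]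
  refine h.le_mul_of_lower_pos hε hp hE hC (c := 1) ?_ zero_lt_one fun i _ => ?_
  · rw [Set.Icc.coe_one]; linarith
  · rw [min_eq_left (le_one' : p i ≤ 1), bernoulliKL_self]
    exact zero_le

end BoundedByAlternatives

lemma bernoulliKL_le_max {p q c : I} (hq : c ≤ q) :
    bernoulliKL p (max p c : I) ≤ bernoulliKL p q := by
  rw [← bernoulliKL_symm p (max p c), ← bernoulliKL_symm p q,
    (show Antitone σ from fun _ _ h => symm_le_symm.2 h).map_max]
  exact bernoulliKL_min_le (symm_le_symm.2 hq)

lemma bernoulliKL_max_le_of_le {p p' c : I} (hp : p' ≤ p) :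
    bernoulliKL p (max p c : I) ≤ bernoulliKL p' c := by
  rw [← bernoulliKL_symm p (max p c), ← bernoulliKL_symm p' c,
    (show Antitone σ from fun _ _ h => symm_le_symm.2 h).map_max]
  exact bernoulliKL_min_le_of_le (symm_le_symm.2 hp)

namespace BoundedByAlternatives

/-- A nearly optimal infeasible instance need be neither ordered nor infeasible with a margin. It
lies on one side, so truncating `p` on that side costs no more per action, and each single
divergence is at most the sum. -/
lemma le_infeasibilityDist_mul (h : BoundedByAlternatives x ε p J a E) (hx : x ∈ I) (hε : 0 ≤ ε)
    (hp : Antitone p) (hfeas : SubsetFeasible x ε p J) (hE : E ≠ ⊤)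
    (hd : infeasibilityDist x ε p J ≠ ⊤) : a ≤ infeasibilityDist x ε p J * E := by
  refine le_mul_of_forall_pos hE fun r hr => ?_
  have hlt : infeasibilityDist x ε p J < infeasibilityDist x ε p J + ENNReal.ofReal r :=
    ENNReal.lt_add_right hd (by simpa using hr)
  conv_lhs at hlt => rw [infeasibilityDist]
  simp only [iInf_lt_iff] at hlt
  obtain ⟨q, hq, hlt⟩ := hlt
  refine le_trans ?_ (mul_le_mul_left hlt.le E)
  have hC := ne_top_of_lt hlt
  have hle : ∀ i ∈ J, bernoulliKL (p i) (q i) ≤ ∑ i ∈ J, bernoulliKL (p i) (q i) :=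
    fun i hi => Finset.single_le_sum (f := fun i => bernoulliKL (p i) (q i))
      (fun _ _ => zero_le) hi
  obtain ⟨-, -, ⟨i₀, -, -⟩, -⟩ := hfeas.exists_le
  have hside : (∀ i, (q i : ℝ) ≤ x - ε) ∨ ∀ i, x + ε ≤ (q i : ℝ) := by
    by_contra! hc
    obtain ⟨⟨i, hi⟩, j, hj⟩ := hc
    exact hq (feasible_of_lt_of_lt hε hi hj)
  rcases hside with hs | hs
  · refine h.le_mul_of_lower hε hp hfeas hE hC
      (c := ⟨x - ε, (q i₀).2.1.trans (hs i₀), by linarith [hx.2]⟩) rfl fun i hi => ?_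
    exact (bernoulliKL_min_le (Subtype.mk_le_mk.2 (hs i))).trans (hle i hi)
  · refine h.le_mul_of_upper hε hp hfeas hE hC
      (c := ⟨x + ε, by linarith [hx.1], (hs i₀).trans (q i₀).2.2⟩) rfl fun i hi => ?_
    exact (bernoulliKL_le_max (Subtype.mk_le_mk.2 (hs i))).trans (hle i hi)

end BoundedByAlternatives

/-- Taking E = 1 lets the truncation lemmas bound d({l}) by the divergence to x ± ε, even when that
boundary point is itself feasible, as for ε = 0. -/
lemma boundedByAlternatives_infeasibilityDist (hε : 0 ≤ ε) (p : Fin k → I) (l : Fin k) :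
    BoundedByAlternatives x ε p {l} (infeasibilityDist x ε p {l}) 1 := fun q _ hq C _ hle => by
  rw [mul_one]
  refine (iInf₂_le q (hq.not_feasible hε)).trans ?_
  simpa using hle l (by simp)

lemma inv_mul_le_of_le_mul {A : ℝ≥0∞} (h : A ≠ ⊤ → a ≤ A * E) : A⁻¹ * a ≤ E := by
  by_cases hA : A = ⊤
  · simp [hA]
  · rw [mul_comm, ← div_eq_mul_inv]
    exact ENNReal.div_le_of_le_mul' (h hA)

/-- Both one-sided bounds hold for any family of actions that dominates the divergences. -/
lemma BoundedByAlternatives.inv_mul_le (h : BoundedByAlternatives x ε p J a E) (hε : 0 ≤ ε)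
    (hp : Antitone p) (hfeas : SubsetFeasible x ε p J) (hE : E ≠ ⊤) {i j : Fin k}
    (hi : ∀ m ∈ J, p m ≤ p i) (hj : ∀ m ∈ J, p j ≤ p m) :
    (bernoulliKL (p i) (x - ε))⁻¹ * a ≤ E ∧ (bernoulliKL (p j) (x + ε))⁻¹ * a ≤ E := by
  refine ⟨inv_mul_le_of_le_mul fun hA => ?_, inv_mul_le_of_le_mul fun hA => ?_⟩
  · exact h.le_mul_of_lower hε hp hfeas hE hA
      (c := ⟨_, mem_unitInterval_of_bernoulliKL_ne_top hA⟩) rfl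
      fun m hm => bernoulliKL_min_le_of_le (hi m hm)
  · exact h.le_mul_of_upper hε hp hfeas hE hA
      (c := ⟨_, mem_unitInterval_of_bernoulliKL_ne_top hA⟩) rfl
      fun m hm => bernoulliKL_max_le_of_le (hj m hm)

lemma Policy.SoundOn.boundedByAlternatives {π : Policy k} {δ : ℝ} {M : Set (Fin k → I)}
    (hπ : π.SoundOn x ε δ M) (hε : 0 ≤ ε) (hδ : 0 < δ) (hδ' : δ < 1 / 2)
    (hfeas : Feasible x ε p) (hpM : p ∈ M)
    (hM : ∀ q : Fin k → I, Antitone q → StrictlyInfeasible x ε q → q ∈ M)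
    (hJ : π.PlaysOnly J) :
    BoundedByAlternatives x ε p J (ENNReal.ofReal (Real.log (1 / (4 * δ))))
      -- Only actions that the run can play need small divergence, so restricting the play to `J`
      -- restricts the condition to `J`.
      (π.expectedStoppingTime p) := fun q hq hqs _ hC hle =>
  π.log_le_mul_expectedStoppingTime p q hδ hδ' (hπ p hpM).1 ((hπ p hpM).2.1 hfeas)
    ((hπ q (hM q hq hqs)).2.2 (hqs.not_feasible hε)) hC fun ω t i hi => hle i (hJ ω t i hi)

end HullFeasibility

/-! ### The lower bounds for singletons and for the extreme pair -/

open HullFeasibility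
/-- The actions `1, …, k` are `0, …, n : Fin (n + 1)`. The second alternative of `hJ` is the learner
who is told an optimal subset by the oracle and plays only actions in it. -/
theorem mainTheorem2 (n : ℕ) (x ε δ : ℝ) (hx : x ∈ Set.Icc (0 : ℝ) 1) (hε : 0 ≤ ε)
    (hδ : 0 < δ) (hδ' : δ < 1 / 2)
    (p : Fin (n + 1) → unitInterval) (hp : Antitone p) (hfeas : Feasible x ε p)
    (M : Set (Fin (n + 1) → unitInterval)) (hpM : p ∈ M)
    (hM : ∀ q : Fin (n + 1) → unitInterval, Antitone q → StrictlyInfeasible x ε q → q ∈ M)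
    (π : Policy (n + 1)) (hπ : π.SoundOn x ε δ M)
    (J : Finset (Fin (n + 1)))
    (hJ : J ∈ optimalIn (feasibleSubsets x ε p) x ε p ∨
      (J ∈ optimalIn (minimalFeasibleSubsets x ε p) x ε p ∧ π.PlaysOnly J)) :
    (∀ l, J = {l} →
      max (bernoulliKL (p l) (x - ε))⁻¹ (bernoulliKL (p l) (x + ε))⁻¹
          * ENNReal.ofReal (1 / 2 * Real.log (1 / (4 * δ)))
        ≤ π.expectedStoppingTime p) ∧
    (J = {0, Fin.last n} →
      ((bernoulliKL (p 0) (x - ε))⁻¹ + (bernoulliKL (p (Fin.last n)) (x + ε))⁻¹)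
          * ENNReal.ofReal (1 / 2 * Real.log (1 / (4 * δ)))
        ≤ π.expectedStoppingTime p) := by
  have hE : π.expectedStoppingTime p ≠ ⊤ := (hπ p hpM).1.ne
  have hall := hπ.boundedByAlternatives hε hδ hδ' hfeas hpM hM (J := Finset.univ)
    fun _ _ i _ => Finset.mem_univ i
  have e : ENNReal.ofReal (1 / 2 * Real.log (1 / (4 * δ))) =
      2⁻¹ * ENNReal.ofReal (Real.log (1 / (4 * δ))) := by
    rw [ENNReal.ofReal_mul (by norm_num), one_div 2, ENNReal.ofReal_inv_of_pos two_pos,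
      ENNReal.ofReal_ofNat]
  rw [e]
  set a := ENNReal.ofReal (Real.log (1 / (4 * δ)))
  refine ⟨fun l hl => ?_, fun _ => ?_⟩
  · subst hl
    have key : (bernoulliKL (p l) (x - ε))⁻¹ * a ≤ π.expectedStoppingTime p ∧
        (bernoulliKL (p l) (x + ε))⁻¹ * a ≤ π.expectedStoppingTime p := by
      rcases hJ with hJ | ⟨hJ, hplay⟩
      · have hl : SubsetFeasible x ε p {l} := hJ.1
        -- The full set of actions is itself a competitor, so its distance is at most d({l}).
        have hle := hJ.2 Finset.univ hfeas
        have hb : ∀ A : ℝ≥0∞, A ≠ ⊤ → infeasibilityDist x ε p {l} ≤ A →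
            a ≤ A * π.expectedStoppingTime p := fun A hA hlA =>
          (hall.le_infeasibilityDist_mul hx hε hp hfeas hE
            (ne_top_of_le_ne_top hA (hle.trans hlA))).trans
            (mul_le_mul_left (hle.trans hlA) _)
        have hd := boundedByAlternatives_infeasibilityDist (x := x) hε p l
        refine ⟨inv_mul_le_of_le_mul fun hA => hb _ hA ?_,
          inv_mul_le_of_le_mul fun hA => hb _ hA ?_⟩
        · rw [← mul_one (bernoulliKL _ _)]
          refine hd.le_mul_of_lower hε hp hl ENNReal.one_ne_top hA
            (c := ⟨_, mem_unitInterval_of_bernoulliKL_ne_top hA⟩) rfl fun m hm => ?_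
          rw [Finset.mem_singleton.1 hm]
          exact bernoulliKL_min_le_of_le le_rfl
        · rw [← mul_one (bernoulliKL _ _)]
          refine hd.le_mul_of_upper hε hp hl ENNReal.one_ne_top hA
            (c := ⟨_, mem_unitInterval_of_bernoulliKL_ne_top hA⟩) rfl fun m hm => ?_
          rw [Finset.mem_singleton.1 hm]
          exact bernoulliKL_max_le_of_le le_rfl
      · exact (hπ.boundedByAlternatives hε hδ hδ' hfeas hpM hM hplay).inv_mul_le hε hp hJ.1.1 hE
          (by simp) (by simp)
    have h2 : 2⁻¹ * a ≤ a := mul_le_of_le_one_left (zero_le) (by simp)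
    refine (mul_le_mul_right h2 _).trans ?_
    rcases max_choice (bernoulliKL (p l) (x - ε))⁻¹ (bernoulliKL (p l) (x + ε))⁻¹ with h | h <;>
      rw [h]
    exacts [key.1, key.2]
  · obtain ⟨h1, h2⟩ := hall.inv_mul_le hε hp hfeas hE (i := 0) (j := Fin.last n)
      (fun m _ => hp (Fin.zero_le m)) (fun m _ => hp (Fin.le_last m))
    -- Each term separately is at most E[τ], so their average is too.
    calc _ = 2⁻¹ * ((bernoulliKL (p 0) (x - ε))⁻¹ * a) +
          2⁻¹ * ((bernoulliKL (p (Fin.last n)) (x + ε))⁻¹ * a) := by ring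
      _ ≤ 2⁻¹ * π.expectedStoppingTime p + 2⁻¹ * π.expectedStoppingTime p := by gcongr
      _ = π.expectedStoppingTime p := by
          rw [← add_mul, ENNReal.inv_two_add_inv_two, one_mul]
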